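/- **Theorem (number of $(a,b,c,d)$-dipoles on the torus).** A *rooted dipole* is a 2-cell embedding, in an oriented closed surface, of a loopless graph with exactly two vertices, with a distinguished root edge and root vertex, considered up to orientation-preserving isomorphism. For a partition $\lambda$, let $\psi_\lambda$ be the number of rooted dipoles (with $|\lambda|$ edges) whose face-degree sequence is $2\lambda$; set $\psi_{3,1^k}=\psi_{2^2,1^k}=0$ for $k<0$. Now let a rooted dipole carry in addition a secondary edge different from the root edge. At the root vertex, Region 1 is the sector counterclockwise from the root edge to the secondary edge and Region 2 the sector counterclockwise from the secondary edge to the root edge; at the other vertex, Region 3 is the sector counterclockwise from the root edge to the secondary edge and Region 4 the sector counterclockwise from the secondary edge to the root edge. Every other edge has its two ends in Regions 2 and 3 (an $a$-edge), 1 and 3 ($b$-edge), 2 and 4 ($c$-edge), or 1 and 4 ($d$-edge). An *$(a,b,c,d)$-dipole* is a rooted dipole with a secondary edge that has exactly $a$, $b$, $c$, $d$ edges of these respective types; so it has $a+b+c+d+2$ edges. Let $a,b,c,d\ge 0$ be integers, and suppose first that $c+d>0$. When $b\ge 1$, the number of $(a,b,c,d)$-dipoles on the torus is $$\begin{cases}(a+1)\,b\,(d+1)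 & \text{if } c=0,\\ (a+1)(d+1) & \text{if } c\ge 1.\end{cases}$$ When $b=0$, the number of $(a,b,c,d)$-dipoles on the torus is $$\begin{cases}\binom{d+2}{d-2}+\psi_{3,1^{a-2}}+\psi_{2^2,1^{a-3}} & \text{if } c=0,\\ (a+1)(d+1) & \text{if } c=1,\\ (a+1)\,c\,(d+1) & \text{if } c\ge 2,\end{cases}$$ where $\binom{d+2}{d-2}=0$ if $d<2$. When $c=d=0$, the number of $(a,b,0,0)$-dipoles on the torus is $b(a+1)$ if $b\ge 1$, and $\psi_{3,1^{a-2}}+\psi_{2^2,1^{a-3}}$ if $b=0$. -/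

import Mathlib

/-!
Dipoles: loopless 2-cell embeddings of a graph with exactly two vertices in an oriented
surface, given by their rotation systems and counted up to isomorphism.
-/

/-- A rooted dipole with edges labelled by `Fin n`: a rotation system on the two-vertex loopless
graph in which every edge joins the root vertex (`true`) to the non-root vertex (`false`),
together with a root edge. `rot v` sends an edge to the next edge in counterclockwise
order around `v`. -/
structure RootedDipole (n : ℕ) where
  rot : Bool → Equiv.Perm (Fin n)
  isCycle : ∀ v, (rot v).IsCycleOn Set.univ
  root : Fin n

/-- A rooted dipole with a second distinguished edge, the secondary edge. -/
structure BirootedDipole (n : ℕ) extends RootedDipole n where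
  secondary : Fin n
  secondary_ne : secondary ≠ root

namespace RootedDipole

variable {n : ℕ}

/-- The face permutation on darts. The dart `(v, e)` is the edge `e` traversed away from its end
at `v`. Walking with the face on the left, one arrives at the opposite vertex `!v` and leaves it
along the edge which precedes `e` in the counterclockwise order around `!v`. -/
def facePerm (D : RootedDipole n) : Equiv.Perm (Bool × Fin n) where
  toFun x := (!x.1, (D.rot (!x.1)).symm x.2)
  invFun x := (!x.1, D.rot x.1 x.2)
  left_inv x := by simp
  right_inv x := by simp

/-- The multiset of face degrees. A face is an orbit of the face permutation and its degree is the
size of the orbit; no dart is fixed, so `cycleType` lists every orbit. -/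
def faceDegrees (D : RootedDipole n) : Multiset ℕ :=
  D.facePerm.cycleType

/-- The embedding surface has genus `g`, by the Euler-Poincaré formula `V - E + F = 2 - 2g`. -/
def HasGenus (D : RootedDipole n) (g : ℕ) : Prop :=
  (2 : ℤ) - (n : ℤ) + (Multiset.card D.faceDegrees : ℤ) = 2 - 2 * (g : ℤ)

/-- Rooted dipoles are isomorphic when they differ by a relabelling of the edges which preserves
the two rotations and the root edge (and the root vertex). -/
def isoSetoid (n : ℕ) : Setoid (RootedDipole n) where
  r D D' := ∃ π : Equiv.Perm (Fin n),
    (∀ v e, D'.rot v (π e) = π (D.rot v e)) ∧ D'.root = π D.root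
  iseqv :=
    { refl := fun _ => ⟨1, by simp⟩
      symm := by
        rintro D D' ⟨π, h, hr⟩
        refine ⟨π⁻¹, fun v e => ?_, by simp [hr]⟩
        rw [Equiv.Perm.eq_inv_iff_eq, ← h]
        simp
      trans := by
        rintro D D' D'' ⟨π, h, hr⟩ ⟨π', h', hr'⟩
        exact ⟨π' * π, fun v e => by simp [h, h'], by simp [hr, hr']⟩ }

end RootedDipole

namespace BirootedDipole

variable {n : ℕ}

/-- Isomorphism of dipoles with a root edge and a secondary edge. -/
def isoSetoid (n : ℕ) : Setoid (BirootedDipole n) where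
  r D D' := ∃ π : Equiv.Perm (Fin n),
    (∀ v e, D'.rot v (π e) = π (D.rot v e)) ∧ D'.root = π D.root ∧
      D'.secondary = π D.secondary
  iseqv :=
    { refl := fun _ => ⟨1, by simp⟩
      symm := by
        rintro D D' ⟨π, h, hr, hs⟩
        refine ⟨π⁻¹, fun v e => ?_, by simp [hr], by simp [hs]⟩
        rw [Equiv.Perm.eq_inv_iff_eq, ← h]
        simp
      trans := by
        rintro D D' D'' ⟨π, h, hr, hs⟩ ⟨π', h', hr', hs'⟩
        exact ⟨π' * π, fun v e => by simp [h, h'], by simp [hr, hr'], by simp [hs, hs']⟩ }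

/-- Turning counterclockwise around the vertex `v` from the edge `x`, one meets the edge `e`
strictly before the edge `y` (within one turn). -/
def Between (D : BirootedDipole n) (v : Bool) (x e y : Fin n) : Prop :=
  ∃ i j : ℕ, 0 < i ∧ i < j ∧ j < n ∧ ((D.rot v) ^ i) x = e ∧ ((D.rot v) ^ j) x = y

/-- Region 1: at the root vertex, counterclockwise from the root edge to the secondary edge. -/
def InRegion1 (D : BirootedDipole n) (e : Fin n) : Prop :=
  D.Between true D.root e D.secondary

/-- Region 2: at the root vertex, counterclockwise from the secondary edge to the root edge. -/
def InRegion2 (D : BirootedDipole n) (e : Fin n) : Prop :=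
  D.Between true D.secondary e D.root

/-- Region 3: at the non-root vertex, counterclockwise from the root to the secondary edge. -/
def InRegion3 (D : BirootedDipole n) (e : Fin n) : Prop :=
  D.Between false D.root e D.secondary

/-- Region 4: at the non-root vertex, counterclockwise from the secondary to the root edge. -/
def InRegion4 (D : BirootedDipole n) (e : Fin n) : Prop :=
  D.Between false D.secondary e D.root

/-- `D` has exactly `a` edges with ends in Regions 2 and 3, `b` edges with ends in Regions 1 and 3,
`c` edges with ends in Regions 2 and 4, and `d` edges with ends in Regions 1 and 4. -/
def HasType (D : BirootedDipole n) (a b c d : ℕ) : Prop :=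
  {e | D.InRegion2 e ∧ D.InRegion3 e}.ncard = a ∧
  {e | D.InRegion1 e ∧ D.InRegion3 e}.ncard = b ∧
  {e | D.InRegion2 e ∧ D.InRegion4 e}.ncard = c ∧
  {e | D.InRegion1 e ∧ D.InRegion4 e}.ncard = d

end BirootedDipole

/-- `ψ_λ`: the number of rooted dipoles, up to isomorphism, on orientable surfaces, with face-degree
sequence `2λ`. Such a dipole has `|λ|` edges. -/
noncomputable def psi (l : Multiset ℕ) : ℕ :=
  (Quotient.mk (RootedDipole.isoSetoid l.sum) ''
    {D | D.faceDegrees = l.map (fun k => 2 * k)}).ncard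

/-- `ψ_{3,1^k}` for an integer `k`, zero when `k < 0`. -/
noncomputable def psiThree (k : ℤ) : ℕ :=
  if 0 ≤ k then psi (3 ::ₘ Multiset.replicate k.toNat 1) else 0

/-- `ψ_{2²,1^k}` for an integer `k`, zero when `k < 0`. -/
noncomputable def psiTwoTwo (k : ℤ) : ℕ :=
  if 0 ≤ k then psi (2 ::ₘ 2 ::ₘ Multiset.replicate k.toNat 1) else 0

/-- The number of `(a,b,c,d)`-dipoles, up to isomorphism, on the orientable surface of genus `g`.
Such a dipole has `a + b + c + d + 2` edges: the typed edges, the root and the secondary edge. -/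
noncomputable def numDipoles (g a b c d : ℕ) : ℕ :=
  (Quotient.mk (BirootedDipole.isoSetoid (a + b + c + d + 2)) ''
    {D | D.toRootedDipole.HasGenus g ∧ D.HasType a b c d}).ncard

/-! Number the edges counterclockwise around the root vertex, the root edge being 0, so that the
rotation there is the shift `c = finRotate`. Around the other vertex the edges appear clockwise in
an order given by a permutation `P` with `P 0 = 0`. A root leaves no automorphisms, so `P`
determines the isomorphism class and conversely (`eq_of_iso_ofPos`).

Faces are the orbits of `ρ = P⁻¹ c P c⁻¹`. By Euler's formula the surface is a torus exactly when
the excesses (length minus one) of the cycles of `ρ` sum to 2: `ρ` is a 3-cycle or a product of two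
disjoint transpositions. Moreover `ρ * c` must be a full cycle, which rules out all but the crossing
patterns `swap x z * swap y t` with `x < y ≤ z < t` (`exists_swap_mul_swap`). Gluing the pieces of
the word at these cuts shows that `P` interchanges two blocks `[i, j)` and `[k, l)` of `[1, n)`,
where `1 ≤ i < j ≤ k < l ≤ n`; every such interchange occurs, and the quadruple is unique. Torus
dipoles are thus lattice points.

A secondary edge `s` has type `(a, b, c, d)` when `s = b + d + 1`, with `b` smaller edges placed
after it and `c` larger edges placed before it. For a block interchange these two numbers depend
only on which of the five pieces of the word contains `s` (`blockCrossing_ncard`), and each case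
becomes a count of quadruples. If `b = c = 0`, both blocks lie below `s` or both lie above it. The
first kind gives a binomial coefficient; the second kind is the set of all rooted torus dipoles with
`a + 1` edges, whose half face degrees have excess 2 and so are `3, 1, …` or `2, 2, 1, …`: this is
the sum of the two `ψ` terms. -/

/-! ### Orbit counts, and multisets of small excess -/

/-- If the fibres of `f` refine those of `g` on `S`, then `g` has at most as many values as `f`. -/
theorem Finset.card_image_le_card_image_of_refines {α β γ : Type*} [DecidableEq β] [DecidableEq γ]
    (S : Finset α) (f : α → β) (g : α → γ) (h : ∀ x ∈ S, ∀ y ∈ S, f x = f y → g x = g y) :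
    (S.image g).card ≤ (S.image f).card := by
  classical
  rcases S.eq_empty_or_nonempty with rfl | ⟨x₀, _⟩
  · simp
  have : Nonempty α := ⟨x₀⟩
  have hr : ∀ b ∈ S.image f, ∃ x, x ∈ S ∧ f x = b := fun b hb => by
    obtain ⟨x, hx, rfl⟩ := Finset.mem_image.1 hb
    exact ⟨x, hx, rfl⟩
  choose! r hr1 hr2 using hr
  refine (Finset.card_le_card ?_).trans (Finset.card_image_le (s := S.image f) (f := g ∘ r))
  intro c hc
  obtain ⟨x, hx, rfl⟩ := Finset.mem_image.1 hc
  have hfx : f x ∈ S.image f := Finset.mem_image_of_mem f hx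
  exact Finset.mem_image.2 ⟨f x, hfx, h _ (hr1 _ hfx) _ hx (hr2 _ hfx)⟩

namespace Equiv.Perm

/-- A function constant exactly on the orbits of `ρ` has as many values as `ρ` has orbits. -/
theorem card_image_add_card_support {α β : Type*} [Fintype α] [DecidableEq α] [DecidableEq β]
    (ρ : Perm α) (f : α → β) (hf : ∀ x y, f x = f y ↔ ρ.SameCycle x y) :
    (Finset.univ.image f).card + ρ.support.card =
      Fintype.card α + Multiset.card ρ.cycleType := by
  -- `cycleType` omits fixed points, so the orbits inside and outside the support are counted
  -- separately; each fixed point is an orbit by itself.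
  have h1 : Finset.univ.image f = ρ.support.image f ∪ ρ.supportᶜ.image f := by
    rw [← Finset.image_union, Finset.union_compl]
  have h2 : _root_.Disjoint (ρ.support.image f) (ρ.supportᶜ.image f) := by
    rw [Finset.disjoint_left]
    intro b hb hb'
    obtain ⟨x, hx, rfl⟩ := Finset.mem_image.1 hb
    obtain ⟨y, hy, hxy⟩ := Finset.mem_image.1 hb'
    exact Finset.mem_compl.1 hy ((((hf _ _).1 hxy).mem_support_iff).2 hx)
  have h3 : (ρ.supportᶜ.image f).card = ρ.supportᶜ.card := by
    refine Finset.card_image_of_injOn fun x hx y _ hxy => ?_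
    exact ((hf _ _).1 hxy).eq_of_left (by simpa [Function.IsFixedPt] using hx)
  have h4 : (ρ.support.image f).card = Multiset.card ρ.cycleType := by
    have h5 : ρ.support.image (cycleOf ρ) = ρ.cycleFactorsFinset := by
      ext c
      refine ⟨fun hc => ?_, fun hc => ?_⟩
      · obtain ⟨x, hx, rfl⟩ := Finset.mem_image.1 hc
        exact cycleOf_mem_cycleFactorsFinset_iff.2 hx
      · have hcyc := (mem_cycleFactorsFinset_iff.1 hc).1
        obtain ⟨x, hx⟩ := hcyc.nonempty_support
        refine Finset.mem_image.2 ⟨x, mem_cycleFactorsFinset_support_le hc hx, ?_⟩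
        exact (cycle_is_cycleOf hx hc).symm
    have h6 : Multiset.card ρ.cycleType = (ρ.support.image (cycleOf ρ)).card := by
      rw [h5, cycleType_def, Multiset.card_map]; rfl
    rw [h6]
    refine le_antisymm
      (Finset.card_image_le_card_image_of_refines _ _ _ fun x hx y _ hxy => ?_)
      (Finset.card_image_le_card_image_of_refines _ _ _ fun x _ y _ hxy => ?_)
    · rw [hf]
      exact (sameCycle_iff_cycleOf_eq_of_mem_support hx (by assumption)).2 hxy
    · exact ((hf _ _).1 hxy).cycleOf_eq
  rw [h1, Finset.card_union_of_disjoint h2, h3, h4, Finset.card_compl]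
  have := Finset.card_le_univ ρ.support
  omega

/-- A perm without fixed points has as many orbits as cycles. -/
theorem card_image_eq_card_cycleType {α β : Type*} [Fintype α] [DecidableEq α] [DecidableEq β]
    (ρ : Perm α) (f : α → β) (hf : ∀ x y, f x = f y ↔ ρ.SameCycle x y) (h : ∀ x, ρ x ≠ x) :
    (Finset.univ.image f).card = Multiset.card ρ.cycleType := by
  have h1 := card_image_add_card_support ρ f hf
  have h2 : ρ.support = Finset.univ := by ext; simp [h]
  rw [h2, Finset.card_univ] at h1
  omega

end Equiv.Perm

theorem Multiset.eq_replicate_one_of_sum_eq_card {N : Multiset ℕ} (hpos : ∀ x ∈ N, 1 ≤ x)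
    (h : N.sum = N.card) : N = Multiset.replicate N.card 1 := by
  induction N using Multiset.induction with
  | empty => simp
  | cons x N ih =>
    have h1 : N.card ≤ N.sum := by
      simpa using Multiset.card_nsmul_le_sum (s := N) (a := 1) fun y hy => hpos y (by simp [hy])
    have hx := hpos x (by simp)
    simp only [Multiset.sum_cons, Multiset.card_cons] at h
    have := ih (fun y hy => hpos y (by simp [hy])) (by omega)
    rw [Multiset.card_cons, Multiset.replicate_succ, ← this]
    congr 1
    omega

theorem Multiset.eq_two_cons_of_sum_eq_card_add_one {N : Multiset ℕ} (hpos : ∀ x ∈ N, 1 ≤ x)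
    (h : N.sum = N.card + 1) : N = 2 ::ₘ Multiset.replicate (N.card - 1) 1 := by
  have : ∃ x ∈ N, x ≠ 1 := by
    by_contra! hc
    rw [Multiset.eq_replicate_card.2 hc] at h
    simp at h
  obtain ⟨x, hx, hx1⟩ := this
  obtain ⟨M, rfl⟩ := Multiset.exists_cons_of_mem hx
  have hM : ∀ y ∈ M, 1 ≤ y := fun y hy => hpos y (by simp [hy])
  have h1 : M.card ≤ M.sum := by
    simpa using Multiset.card_nsmul_le_sum (s := M) (a := 1) hM
  have hx0 := hpos x (by simp)
  simp only [Multiset.sum_cons, Multiset.card_cons] at h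
  rw [Multiset.card_cons, Nat.add_sub_cancel, ← eq_replicate_one_of_sum_eq_card hM (by omega)]
  congr 1
  omega

/-- The numbers `x - 1` are nonnegative and sum to 2, so the total is either one 2 or two 1s. -/
theorem Multiset.eq_of_sum_eq_card_add_two {N : Multiset ℕ} (hpos : ∀ x ∈ N, 1 ≤ x)
    (h : N.sum = N.card + 2) :
    N = 3 ::ₘ Multiset.replicate (N.card - 1) 1 ∨
      (2 ≤ N.card ∧ N = 2 ::ₘ 2 ::ₘ Multiset.replicate (N.card - 2) 1) := by
  have : ∃ x ∈ N, x ≠ 1 := by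
    by_contra! hc
    rw [Multiset.eq_replicate_card.2 hc] at h
    simp at h
  obtain ⟨x, hx, hx1⟩ := this
  obtain ⟨M, rfl⟩ := Multiset.exists_cons_of_mem hx
  have hM : ∀ y ∈ M, 1 ≤ y := fun y hy => hpos y (by simp [hy])
  have h1 : M.card ≤ M.sum := by
    simpa using Multiset.card_nsmul_le_sum (s := M) (a := 1) hM
  have hx0 := hpos x (by simp)
  simp only [Multiset.sum_cons, Multiset.card_cons] at h
  obtain rfl | rfl : x = 2 ∨ x = 3 := by omega
  · right
    have h2 := eq_two_cons_of_sum_eq_card_add_one hM (by omega)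
    have h3 : 1 ≤ M.card := by rw [h2]; simp
    refine ⟨by rw [Multiset.card_cons]; omega, ?_⟩
    rw [Multiset.card_cons, show M.card + 1 - 2 = M.card - 1 by omega, ← h2]
  · left
    rw [Multiset.card_cons, Nat.add_sub_cancel, ← eq_replicate_one_of_sum_eq_card hM (by omega)]

namespace Equiv.Perm

theorem cycleType_eq_of_card_support {α : Type*} [Fintype α] [DecidableEq α] {ρ : Perm α}
    (h : ρ.support.card = Multiset.card ρ.cycleType + 2) :
    ρ.cycleType = {3} ∨ ρ.cycleType = {2, 2} := by
  rw [← sum_cycleType] at h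
  have h1 : 1 ∉ ρ.cycleType := fun hh => by have := two_le_of_mem_cycleType hh; omega
  rcases Multiset.eq_of_sum_eq_card_add_two (fun x hx => by
    have := two_le_of_mem_cycleType hx; omega) h with h2 | ⟨h3, h2⟩
  · generalize Multiset.card ρ.cycleType - 1 = k at h2
    cases k with
    | zero => left; simpa using h2
    | succ k => exact absurd (by rw [h2]; simp) h1
  · generalize Multiset.card ρ.cycleType - 2 = k at h2
    cases k with
    | zero => right; simpa using h2
    | succ k => exact absurd (by rw [h2]; simp) h1

end Equiv.Perm

/-! ### Block interchanges -/

/-- The position of the edge `e` after interchanging the blocks `[i, j)` and `[k, l)`, that is, in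
the word `[0, i) [k, l) [j, k) [i, j) [l, …)`. -/
def blockPos (i j k l e : ℕ) : ℕ :=
  if e < i then e
  else if e < j then l - j + e
  else if e < k then i + (l - k) + (e - j)
  else if e < l then i + (e - k)
  else e

/-- The two blocks `[i, j)` and `[k, l)` are nonempty, in this order, inside `[1, n)`. -/
def IsBlockPair (n i j k l : ℕ) : Prop :=
  1 ≤ i ∧ i < j ∧ j ≤ k ∧ k < l ∧ l ≤ n

theorem blockPos_cases (i j k l e : ℕ) :
    (e < i ∧ blockPos i j k l e = e) ∨
    (i ≤ e ∧ e < j ∧ blockPos i j k l e = l - j + e) ∨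
    (i ≤ e ∧ j ≤ e ∧ e < k ∧ blockPos i j k l e = i + (l - k) + (e - j)) ∨
    (i ≤ e ∧ j ≤ e ∧ k ≤ e ∧ e < l ∧ blockPos i j k l e = i + (e - k)) ∨
    (i ≤ e ∧ j ≤ e ∧ k ≤ e ∧ l ≤ e ∧ blockPos i j k l e = e) := by
  unfold blockPos
  split_ifs <;> omega

theorem blockPos_lt {n i j k l e : ℕ} (h : IsBlockPair n i j k l) (he : e < n) :
    blockPos i j k l e < n := by
  have := blockPos_cases i j k l e
  unfold IsBlockPair at h
  omega

theorem blockPos_injective {n i j k l e e' : ℕ} (h : IsBlockPair n i j k l)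
    (he : blockPos i j k l e = blockPos i j k l e') : e = e' := by
  have := blockPos_cases i j k l e
  have := blockPos_cases i j k l e'
  unfold IsBlockPair at h
  omega

open scoped Classical in
/-- The block interchange as a permutation (the identity if the blocks are not admissible). -/
noncomputable def blockPerm (m i j k l : ℕ) : Equiv.Perm (Fin (m + 1)) :=
  if h : Function.Bijective fun e : Fin (m + 1) => Fin.ofNat (m + 1) (blockPos i j k l e) then
    Equiv.ofBijective _ h
  else 1

theorem blockPerm_val {m i j k l : ℕ} (h : IsBlockPair (m + 1) i j k l) (e : Fin (m + 1)) :
    (blockPerm m i j k l e : ℕ) = blockPos i j k l e := by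
  have hv : ∀ e : Fin (m + 1),
      (Fin.ofNat (m + 1) (blockPos i j k l e) : ℕ) = blockPos i j k l e := fun e => by
    rw [Fin.val_ofNat, Nat.mod_eq_of_lt (blockPos_lt h e.2)]
  have hb : Function.Bijective fun e : Fin (m + 1) =>
      Fin.ofNat (m + 1) (blockPos i j k l e) := by
    refine Finite.injective_iff_bijective.1 fun e e' hee => Fin.ext (blockPos_injective h ?_)
    exact (hv e).symm.trans ((congrArg Fin.val hee).trans (hv e'))
  rw [blockPerm, dif_pos hb]
  exact hv e

theorem blockPerm_zero {m i j k l : ℕ} (h : IsBlockPair (m + 1) i j k l) :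
    blockPerm m i j k l 0 = 0 := by
  apply Fin.ext
  rw [blockPerm_val h]
  have := blockPos_cases i j k l 0
  unfold IsBlockPair at h
  simp only [Fin.val_zero]
  omega

/-- The first moved point is `i` and the last is `l - 1`. Their images `l - j + i` and `i + (l - 1 -
k)` then give `j` and `k`. -/
theorem eq_of_blockPos_eq {n i j k l i' j' k' l' : ℕ} (h : IsBlockPair n i j k l)
    (h' : IsBlockPair n i' j' k' l')
    (he : ∀ e < n, blockPos i j k l e = blockPos i' j' k' l' e) :
    i = i' ∧ j = j' ∧ k = k' ∧ l = l' := by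
  unfold IsBlockPair at h h'
  obtain rfl : i = i' := by
    have a1 := he i (by omega)
    have a2 := he i' (by omega)
    have := blockPos_cases i j k l i
    have := blockPos_cases i j k l i'
    have := blockPos_cases i' j' k' l' i
    have := blockPos_cases i' j' k' l' i'
    omega
  obtain rfl : l = l' := by
    have a1 := he (l - 1) (by omega)
    have a2 := he (l' - 1) (by omega)
    have := blockPos_cases i j k l (l - 1)
    have := blockPos_cases i j k l (l' - 1)
    have := blockPos_cases i j' k' l' (l - 1)
    have := blockPos_cases i j' k' l' (l' - 1)
    omega
  have a1 := he i (by omega)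
  have a2 := he (l - 1) (by omega)
  have := blockPos_cases i j k l i
  have := blockPos_cases i j k l (l - 1)
  have := blockPos_cases i j' k' l i
  have := blockPos_cases i j' k' l (l - 1)
  omega

theorem val_finRotate_cases {m : ℕ} (e : Fin (m + 1)) :
    (e.val = m ∧ (finRotate (m + 1) e).val = 0) ∨
      (e.val < m ∧ (finRotate (m + 1) e).val = e.val + 1) := by
  have := e.2
  have : (finRotate (m + 1) e).val = if e = Fin.last m then 0 else e.val + 1 := coe_finRotate e
  split_ifs at this with h
  · subst h; left; exact ⟨rfl, this⟩
  · right
    have : e.val ≠ m := fun hh => h (Fin.ext hh)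
    omega

theorem val_swap_cases {n : ℕ} (x y u : Fin n) :
    (u.val = x.val ∧ (Equiv.swap x y u).val = y.val) ∨
    (u.val = y.val ∧ (Equiv.swap x y u).val = x.val) ∨
      (u.val ≠ x.val ∧ u.val ≠ y.val ∧ (Equiv.swap x y u).val = u.val) := by
  rw [Equiv.swap_apply_def]
  split_ifs with h1 h2
  · subst h1; simp
  · subst h2; simp
  · right; right
    exact ⟨fun h => h1 (Fin.ext h), fun h => h2 (Fin.ext h), rfl⟩

/-- The interchange is a translation on each piece, so successors change only at the cuts `i, j, k,
l`, where the two swaps correct them. Cyclically the cut `l = m + 1` is the cut 0; it then becomes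
the smallest one and the other cuts shift by one name. The case `j = k` has an empty middle piece
and only three cuts. -/
theorem blockPerm_swap_finRotate {m i j k l : ℕ} (h : IsBlockPair (m + 1) i j k l)
    {x y z t : Fin (m + 1)}
    (hq : (x.val = i ∧ y.val = j ∧ z.val = k ∧ t.val = l) ∨
      (x.val = 0 ∧ y.val = i ∧ m + 1 = l ∧
        ((j < k ∧ z.val = j ∧ t.val = k) ∨ (j = k ∧ z.val = i ∧ t.val = j)))) (e : Fin (m + 1)) :
    blockPerm m i j k l ((Equiv.swap x z * Equiv.swap y t) (finRotate (m + 1) e)) =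
      finRotate (m + 1) (blockPerm m i j k l e) := by
  apply Fin.ext
  have b1 := blockPerm_val h e
  have b2 := blockPerm_val h ((Equiv.swap x z * Equiv.swap y t) (finRotate (m + 1) e))
  have c1 := val_finRotate_cases (blockPerm m i j k l e)
  rw [Equiv.Perm.mul_apply] at b2 ⊢
  have c2 := val_finRotate_cases e
  generalize finRotate (m + 1) e = u at *
  have c3 := val_swap_cases y t u
  generalize Equiv.swap y t u = v at *
  have c4 := val_swap_cases x z v
  generalize Equiv.swap x z v = w at *
  have d1 := blockPos_cases i j k l e
  have d2 := blockPos_cases i j k l w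
  have he := e.2
  unfold IsBlockPair at h
  rw [b1] at c1
  rw [b2]
  generalize (finRotate (m + 1) (blockPerm m i j k l e)).val = r at *
  clear b1 b2
  rcases hq with hq | ⟨hx, hy, hl, hq | hq⟩ <;> rcases c2 with c2 | c2 <;> rcases c3 with c3 | c3 | c3 <;>
    rcases c4 with c4 | c4 | c4 <;> omega

theorem exists_blockPair_of_cuts {m : ℕ} {x y z t : Fin (m + 1)} (hxy : x < y) (hyz : y ≤ z)
    (hzt : z < t) : ∃ i j k l, IsBlockPair (m + 1) i j k l ∧
      ((x.val = i ∧ y.val = j ∧ z.val = k ∧ t.val = l) ∨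
      (x.val = 0 ∧ y.val = i ∧ m + 1 = l ∧
        ((j < k ∧ z.val = j ∧ t.val = k) ∨ (j = k ∧ z.val = i ∧ t.val = j)))) := by
  have := t.2
  simp only [Fin.lt_def, Fin.le_def] at hxy hyz hzt
  unfold IsBlockPair
  by_cases hx : x.val = 0
  · by_cases h : y.val = z.val
    · exact ⟨y, t, t, m + 1, by omega, by omega⟩
    · exact ⟨y, z, t, m + 1, by omega, by omega⟩
  · exact ⟨x, y, z, t, by omega, by omega⟩

theorem exists_cuts_of_blockPair {m i j k l : ℕ} (h : IsBlockPair (m + 1) i j k l) :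
    ∃ x y z t : Fin (m + 1), x < y ∧ y ≤ z ∧ z < t ∧
      ((x.val = i ∧ y.val = j ∧ z.val = k ∧ t.val = l) ∨
      (x.val = 0 ∧ y.val = i ∧ m + 1 = l ∧
        ((j < k ∧ z.val = j ∧ t.val = k) ∨ (j = k ∧ z.val = i ∧ t.val = j)))) := by
  unfold IsBlockPair at h
  by_cases hl : l = m + 1
  · by_cases hj : j = k
    · refine ⟨⟨0, by omega⟩, ⟨i, by omega⟩, ⟨i, by omega⟩, ⟨j, by omega⟩, Fin.mk_lt_mk.2 (by omega),
        Fin.mk_le_mk.2 (by omega), Fin.mk_lt_mk.2 (by omega), ?_⟩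
      dsimp only
      omega
    · refine ⟨⟨0, by omega⟩, ⟨i, by omega⟩, ⟨j, by omega⟩, ⟨k, by omega⟩, Fin.mk_lt_mk.2 (by omega),
        Fin.mk_le_mk.2 (by omega), Fin.mk_lt_mk.2 (by omega), ?_⟩
      dsimp only
      omega
  · refine ⟨⟨i, by omega⟩, ⟨j, by omega⟩, ⟨k, by omega⟩, ⟨l, by omega⟩, Fin.mk_lt_mk.2 (by omega),
        Fin.mk_le_mk.2 (by omega), Fin.mk_lt_mk.2 (by omega), ?_⟩
    dsimp only
    omega

/-! ### Permutations of excess two whose product with the shift is a full cycle -/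

open Equiv (Perm swap swap_comm swap_apply_def)
open Equiv.Perm

theorem card_support_swap_mul_swap {α : Type*} [Fintype α] [LinearOrder α] {x y z t : α}
    (hxy : x < y) (hyz : y ≤ z) (hzt : z < t) :
    (swap x z * swap y t).support.card =
      Multiset.card (swap x z * swap y t).cycleType + 2 := by
  rw [← sum_cycleType]
  rcases hyz.eq_or_lt with rfl | hyz
  · have h := isThreeCycle_swap_mul_swap_same hxy.ne' hzt.ne (hxy.trans hzt).ne
    rw [swap_comm y x] at h
    rw [h.cycleType]
    rfl
  · rw [cycleType_swap_mul_swap_of_nodup]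
    · rfl
    · have := hxy.trans hyz
      have := hyz.trans hzt
      have := hxy.trans ‹y < t›
      simp only [List.nodup_cons, List.mem_cons, List.not_mem_nil, or_false, not_or,
        List.nodup_nil, not_false_eq_true, and_true]
      refine ⟨⟨?_, ?_, ?_⟩, ⟨?_, ?_⟩, ?_⟩ <;> first | exact ne_of_lt ‹_› | exact ne_of_gt ‹_›

theorem mem_of_isCycleOn_of_invariant {α : Type*} [Finite α] {f : Perm α}
    (hf : f.IsCycleOn Set.univ) {s : Set α} (hs : ∀ e ∈ s, f e ∈ s) {x : α} (hx : x ∈ s)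
    (y : α) : y ∈ s := by
  obtain ⟨i, hi⟩ := (hf.2 (Set.mem_univ x) (Set.mem_univ y)).exists_nat_pow_eq
  rw [← hi]
  clear hi
  induction i with
  | zero => exact hx
  | succ i ih => rw [pow_succ', Perm.mul_apply]; exact hs _ ih

/-- If `ρ` moved `y` to `x < y` and fixed everything in between, then `ρ * finRotate` would leave
the interval `[x, y)` invariant. -/
theorem apply_ne_of_isCycleOn_mul_finRotate {m : ℕ} {ρ : Perm (Fin (m + 1))}
    (hc : (ρ * finRotate (m + 1)).IsCycleOn Set.univ) {x y : Fin (m + 1)} (hxy : x < y)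
    (hfix : ∀ z, x < z → z < y → ρ z = z) : ρ y ≠ x := by
  intro hρ
  have := mem_of_isCycleOn_of_invariant hc (s := {e | x ≤ e ∧ e < y}) ?_ ⟨le_rfl, hxy⟩ y
  · exact lt_irrefl _ this.2
  · rintro e ⟨he1, he2⟩
    rw [Perm.mul_apply]
    have h1 := val_finRotate_cases e
    have := y.2
    generalize finRotate (m + 1) e = u at *
    simp only [Fin.lt_def, Fin.le_def] at *
    by_cases hu : u = y
    · subst hu
      rw [hρ]
      exact ⟨le_rfl, hxy⟩
    · have hu' : u.val ≠ y.val := fun h => hu (Fin.ext h)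
      rw [hfix u (by omega) (by omega)]
      exact ⟨by show x.val ≤ u.val; omega, by show u.val < y.val; omega⟩

theorem exists_swap_mul_swap {m : ℕ} {ρ : Perm (Fin (m + 1))}
    (hc : (ρ * finRotate (m + 1)).IsCycleOn Set.univ)
    (h : ρ.support.card = Multiset.card ρ.cycleType + 2) :
    ∃ x y z t : Fin (m + 1), x < y ∧ y ≤ z ∧ z < t ∧ ρ = swap x z * swap y t := by
  have key : ∀ {x y : Fin (m + 1)}, x < y → (∀ z, x < z → z < y → z ∉ ρ.support) → ρ y ≠ x :=
    fun hxy hz => apply_ne_of_isCycleOn_mul_finRotate hc hxy fun z h1 h2 => by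
      simpa using hz z h1 h2
  have hs : ∀ u, u ∈ ρ.support → ρ u ∈ ρ.support := fun u => apply_mem_support.2
  have hne : ∀ u, u ∈ ρ.support → ρ u ≠ u := fun u => mem_support.1
  have hinj := ρ.injective
  rcases cycleType_eq_of_card_support h with h3 | h3
  · have hcard : ρ.support.card = 3 := by rw [← sum_cycleType, h3]; rfl
    set o := ρ.support.orderEmbOfFin hcard with ho
    have hmem : ∀ u, u ∈ ρ.support ↔ u = o 0 ∨ u = o 1 ∨ u = o 2 := fun u => by
      rw [← Finset.mem_coe, ← Finset.range_orderEmbOfFin _ hcard, Set.mem_range, Fin.exists_fin_succ]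
      simp [Fin.exists_fin_two, eq_comm, ho]
    have l1 : o 0 < o 1 := o.lt_iff_lt.2 (by decide)
    have l2 : o 1 < o 2 := o.lt_iff_lt.2 (by decide)
    clear_value o
    generalize o 0 = x at *
    generalize o 1 = y at *
    generalize o 2 = z at *
    -- Neighbouring support points cannot be sent downwards to one another, so of the two 3-cycles
    -- only `x → y → z → x` survives.
    have k1 : ρ y ≠ x := key l1 fun w a b => by rw [hmem]; grind
    have k2 : ρ z ≠ y := key l2 fun w a b => by rw [hmem]; grind
    have e1 : ρ y = z := by grind
    have e2 : ρ z = x := by grind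
    have e3 : ρ x = y := by grind
    refine ⟨x, y, y, z, l1, le_rfl, l2, Equiv.ext fun u => ?_⟩
    by_cases hu : u ∈ ρ.support
    · rw [Perm.mul_apply]
      simp only [swap_apply_def]
      grind
    · have : ρ u = u := by simpa using hu
      rw [Perm.mul_apply]
      simp only [swap_apply_def]
      grind
  · have hcard : ρ.support.card = 4 := by rw [← sum_cycleType, h3]; rfl
    have hsq : ∀ u, ρ (ρ u) = u := fun u => by
      have h4 : orderOf ρ = 2 := by rw [← lcm_cycleType, h3]; rfl
      have h5 := pow_orderOf_eq_one ρ
      rw [h4, pow_two] at h5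
      exact Equiv.congr_fun h5 u
    set o := ρ.support.orderEmbOfFin hcard with ho
    have hmem : ∀ u, u ∈ ρ.support ↔ u = o 0 ∨ u = o 1 ∨ u = o 2 ∨ u = o 3 := fun u => by
      rw [← Finset.mem_coe, ← Finset.range_orderEmbOfFin _ hcard, Set.mem_range, Fin.exists_fin_succ,
        Fin.exists_fin_succ]
      simp [Fin.exists_fin_two, eq_comm, ho]
    have l1 : o 0 < o 1 := o.lt_iff_lt.2 (by decide)
    have l2 : o 1 < o 2 := o.lt_iff_lt.2 (by decide)
    have l3 : o 2 < o 3 := o.lt_iff_lt.2 (by decide)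
    clear_value o
    generalize o 0 = x at *
    generalize o 1 = y at *
    generalize o 2 = z at *
    generalize o 3 = t at *
    -- Of the three pairings of four points, `k1` excludes the side-by-side one and `k2` the nested
    -- one; the crossing one remains.
    have k1 : ρ y ≠ x := key l1 fun w a b => by rw [hmem]; grind
    have k2 : ρ z ≠ y := key l2 fun w a b => by rw [hmem]; grind
    have e1 : ρ x = z := by grind
    have e2 : ρ z = x := by grind
    have e3 : ρ y = t := by grind
    have e4 : ρ t = y := by grind
    refine ⟨x, y, z, t, l1, l2.le, l3, Equiv.ext fun u => ?_⟩
    rw [Perm.mul_apply]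
    simp only [swap_apply_def]
    by_cases hu : u ∈ ρ.support
    · grind
    · have : ρ u = u := by simpa using hu
      grind

/-! ### Faces and genus -/

namespace RootedDipole

section Faces

variable {n : ℕ} (D : RootedDipole n)

theorem facePerm_apply (x : Bool × Fin n) :
    D.facePerm x = (!x.1, (D.rot (!x.1))⁻¹ x.2) := rfl

theorem facePerm_pow_fst (i : ℕ) (x : Bool × Fin n) :
    ((D.facePerm ^ i) x).1 = if Even i then x.1 else !x.1 := by
  induction i with
  | zero => simp
  | succ i ih =>
    rw [pow_succ', Perm.mul_apply, facePerm_apply]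
    simp only [ih, Nat.even_add_one]
    split_ifs <;> simp

theorem even_of_facePerm_pow_fst_eq {i : ℕ} {x : Bool × Fin n}
    (h : ((D.facePerm ^ i) x).1 = x.1) : Even i := by
  by_contra hi
  rw [facePerm_pow_fst, if_neg hi] at h
  simp at h

theorem facePerm_apply_ne (x : Bool × Fin n) : D.facePerm x ≠ x := fun h => by
  have := congrArg Prod.fst h
  simp [facePerm_apply] at this

theorem even_of_mem_faceDegrees {k : ℕ} (hk : k ∈ D.faceDegrees) : Even k := by
  rw [faceDegrees, Perm.cycleType_def, Multiset.mem_map] at hk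
  obtain ⟨c, hc, rfl⟩ := hk
  have hc : c ∈ D.facePerm.cycleFactorsFinset := hc
  have hcyc := (Perm.mem_cycleFactorsFinset_iff.1 hc).1
  obtain ⟨x, hx⟩ := hcyc.nonempty_support
  apply D.even_of_facePerm_pow_fst_eq (x := x)
  have h := pow_orderOf_eq_one c
  rw [hcyc.orderOf, Perm.cycle_is_cycleOf hx hc] at h
  have h1 := Equiv.congr_fun h x
  rw [Perm.cycleOf_pow_apply_self, ← Perm.cycle_is_cycleOf hx hc] at h1
  simp only [Function.comp_apply, h1, Perm.one_apply]

theorem sum_faceDegrees : D.faceDegrees.sum = 2 * n := by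
  rw [faceDegrees, Perm.sum_cycleType]
  have : D.facePerm.support = Finset.univ := by
    ext x; simp [D.facePerm_apply_ne x]
  rw [this]
  simp

/-- Two steps of the face permutation on the darts at the non-root vertex. -/
def faceStep : Perm (Fin n) := (D.rot false)⁻¹ * (D.rot true)⁻¹

theorem facePerm_pow_two_mul (i : ℕ) (e : Fin n) :
    (D.facePerm ^ (2 * i)) (false, e) = (false, (D.faceStep ^ i) e) := by
  induction i with
  | zero => simp
  | succ i ih =>
    rw [show 2 * (i + 1) = 2 + 2 * i by ring, pow_add, Perm.mul_apply, ih, pow_two,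
      Perm.mul_apply, facePerm_apply, facePerm_apply, pow_succ', Perm.mul_apply]
    rfl

theorem sameCycle_facePerm_iff (e e' : Fin n) :
    D.facePerm.SameCycle (false, e) (false, e') ↔ D.faceStep.SameCycle e e' := by
  constructor
  · intro h
    obtain ⟨i, hi⟩ := h.exists_nat_pow_eq
    obtain ⟨j, rfl⟩ := (D.even_of_facePerm_pow_fst_eq (by rw [hi])).two_dvd
    rw [facePerm_pow_two_mul] at hi
    exact ⟨j, by simpa using congrArg Prod.snd hi⟩
  · intro h
    obtain ⟨i, hi⟩ := h.exists_nat_pow_eq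
    exact ⟨(2 * i : ℕ), by rw [zpow_natCast, facePerm_pow_two_mul, hi]⟩

/-- Every face alternates between the two vertices, so it meets the darts at the non-root vertex in
exactly one orbit of `faceStep`. -/
theorem card_faceDegrees :
    Multiset.card D.faceDegrees + D.faceStep.support.card =
      n + Multiset.card D.faceStep.cycleType := by
  classical
  let f : Bool × Fin n → Quotient (Perm.SameCycle.setoid D.facePerm) := Quotient.mk _
  have h1 := Perm.card_image_eq_card_cycleType D.facePerm f (fun _ _ => Quotient.eq)
    D.facePerm_apply_ne
  have h2 := Perm.card_image_add_card_support D.faceStep (fun e => f (false, e))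
    (fun e e' => Quotient.eq.trans (D.sameCycle_facePerm_iff e e'))
  have h3 : Finset.univ.image (fun e => f (false, e)) = Finset.univ.image f := by
    ext q
    simp only [Finset.mem_image, Finset.mem_univ, true_and]
    constructor
    · rintro ⟨e, rfl⟩
      exact ⟨_, rfl⟩
    · rintro ⟨⟨v, e⟩, rfl⟩
      cases v with
      | false => exact ⟨e, rfl⟩
      | true =>
        refine ⟨(D.rot false)⁻¹ e, Quotient.sound ?_⟩
        exact Perm.sameCycle_apply_left.2 (Perm.SameCycle.refl D.facePerm (true, e))
  rw [h3, h1, Fintype.card_fin] at h2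
  exact h2

theorem hasGenus_one_iff :
    D.HasGenus 1 ↔ D.faceStep.support.card = Multiset.card D.faceStep.cycleType + 2 := by
  have := D.card_faceDegrees
  unfold HasGenus
  omega

variable {D} {D' : RootedDipole n}

theorem faceDegrees_eq_of_iso {π : Perm (Fin n)} (h : ∀ v e, D'.rot v (π e) = π (D.rot v e)) :
    D'.faceDegrees = D.faceDegrees := by
  have : D'.facePerm =
      Equiv.prodCongrRight (fun _ => π) * D.facePerm * (Equiv.prodCongrRight fun _ => π)⁻¹ := by
    rw [eq_mul_inv_iff_mul_eq]
    ext1 ⟨v, e⟩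
    simp only [Perm.mul_apply, Equiv.prodCongrRight_apply, facePerm_apply]
    rw [Prod.mk.injEq]
    refine ⟨rfl, ?_⟩
    rw [Perm.inv_eq_iff_eq, h]
    simp
  rw [faceDegrees, faceDegrees, this, Perm.cycleType_conj]

theorem HasGenus.of_iso {g : ℕ} {π : Perm (Fin n)}
    (h : ∀ v e, D'.rot v (π e) = π (D.rot v e)) (hg : D.HasGenus g) : D'.HasGenus g := by
  rw [HasGenus, faceDegrees_eq_of_iso h]
  exact hg

end Faces

end RootedDipole

/-! ### Normal form of a rooted dipole -/

theorem val_finRotate_pow {m : ℕ} (x : Fin (m + 1)) {i : ℕ} (hi : i ≤ m + 1) :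
    (x.val + i < m + 1 ∧ ((finRotate (m + 1) ^ i) x).val = x.val + i) ∨
      (m + 1 ≤ x.val + i ∧ ((finRotate (m + 1) ^ i) x).val = x.val + i - (m + 1)) := by
  have hx := x.2
  induction i with
  | zero => exact .inl ⟨by omega, by simp⟩
  | succ i ih =>
    have h1 := ih (by omega)
    have h2 := val_finRotate_cases ((finRotate (m + 1) ^ i) x)
    rw [pow_succ', Perm.mul_apply]
    omega

theorem finRotate_pow_zero {m : ℕ} (x : Fin (m + 1)) : (finRotate (m + 1) ^ x.val) 0 = x := by
  have := val_finRotate_pow (0 : Fin (m + 1)) (i := x.val) x.2.le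
  have := x.2
  apply Fin.ext
  simp only [Fin.val_zero] at *
  omega

theorem isCycleOn_finRotate (m : ℕ) : (finRotate (m + 1)).IsCycleOn Set.univ := by
  refine ⟨Set.bijOn_univ.2 (Equiv.bijective _), fun x _ y _ => ?_⟩
  have h : ∀ x, (finRotate (m + 1)).SameCycle 0 x := fun x =>
    ⟨x.val, by rw [zpow_natCast, finRotate_pow_zero]⟩
  exact (h x).symm.trans (h y)

/-- The powers of the shift carry 0 to every point, so a permutation commuting with it is determined
by its value at 0. -/
theorem eq_one_of_commute_finRotate {m : ℕ} {π : Perm (Fin (m + 1))}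
    (h : Commute π (finRotate (m + 1))) (h0 : π 0 = 0) : π = 1 := by
  ext1 x
  rw [← finRotate_pow_zero x, ← Perm.mul_apply, (h.pow_right x.val).eq, Perm.mul_apply, h0,
    Perm.one_apply]

theorem isCycleOn_univ_conj {α : Type*} {f : Perm α} (h : f.IsCycleOn Set.univ) (g : Perm α) :
    (g * f * g⁻¹).IsCycleOn Set.univ := by
  have := h.conj (g := g)
  rwa [Set.image_univ_of_surjective g.surjective] at this

/-- Every full cycle is conjugate to `finRotate`, with a prescribed image of `0`. -/
theorem exists_conj_finRotate {m : ℕ} {f : Perm (Fin (m + 1))} (hf : f.IsCycleOn Set.univ)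
    (r : Fin (m + 1)) : ∃ g : Perm (Fin (m + 1)), g 0 = r ∧ f * g = g * finRotate (m + 1) := by
  have hf' : f.IsCycleOn (Finset.univ : Finset (Fin (m + 1))) := by simpa using hf
  have hsurj : Function.Surjective fun e : Fin (m + 1) => (f ^ e.val) r := fun y => by
    obtain ⟨i, hi, hy⟩ := hf'.exists_pow_eq (Finset.mem_univ r) (Finset.mem_univ y)
    rw [Finset.card_univ, Fintype.card_fin] at hi
    exact ⟨⟨i, hi⟩, hy⟩
  refine ⟨Equiv.ofBijective _ (Finite.surjective_iff_bijective.1 hsurj), by simp, ?_⟩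
  ext1 e
  simp only [Perm.mul_apply, Equiv.ofBijective_apply]
  rcases val_finRotate_cases e with ⟨h1, h2⟩ | ⟨h1, h2⟩
  · rw [h2, ← Perm.mul_apply, ← pow_succ', h1]
    have := hf'.pow_card_apply (Finset.mem_univ r)
    rw [Finset.card_univ, Fintype.card_fin] at this
    rw [this]; rfl
  · rw [h2, ← Perm.mul_apply, ← pow_succ']

namespace RootedDipole

variable {m : ℕ}

/-- The rooted dipole whose edges are numbered counterclockwise around the root vertex, starting
from the root edge, and appear clockwise around the other vertex in the order given by `P`. -/
def ofPos (P : Perm (Fin (m + 1))) : RootedDipole (m + 1) where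
  rot v := if v then finRotate (m + 1) else P⁻¹ * (finRotate (m + 1))⁻¹ * P
  isCycle v := by
    cases v
    · simpa using isCycleOn_univ_conj (Perm.isCycleOn_inv.2 (isCycleOn_finRotate m)) P⁻¹
    · simpa using isCycleOn_finRotate m
  root := 0

theorem ofPos_rot_true (P : Perm (Fin (m + 1))) : (ofPos P).rot true = finRotate (m + 1) := rfl

theorem ofPos_rot_false (P : Perm (Fin (m + 1))) :
    (ofPos P).rot false = P⁻¹ * (finRotate (m + 1))⁻¹ * P := rfl

theorem hasGenus_one_ofPos_blockPerm {i j k l : ℕ} (h : IsBlockPair (m + 1) i j k l) :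
    (ofPos (blockPerm m i j k l)).HasGenus 1 := by
  obtain ⟨x, y, z, t, hxy, hyz, hzt, hq⟩ := exists_cuts_of_blockPair h
  have h1 : blockPerm m i j k l * (swap x z * swap y t) * finRotate (m + 1) =
      finRotate (m + 1) * blockPerm m i j k l := Equiv.ext (blockPerm_swap_finRotate h hq)
  have h2 : (ofPos (blockPerm m i j k l)).faceStep = swap x z * swap y t := by
    rw [faceStep, ofPos_rot_false, ofPos_rot_true, mul_inv_eq_iff_eq_mul, mul_inv_rev, mul_inv_rev,
      inv_inv, inv_inv, ← h1]
    group
  rw [hasGenus_one_iff, h2]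
  exact card_support_swap_mul_swap hxy hyz hzt

theorem exists_blockPerm_of_hasGenus_one {D : RootedDipole (m + 1)} (hD : D.HasGenus 1) :
    ∃ i j k l, IsBlockPair (m + 1) i j k l ∧ ∃ g : Perm (Fin (m + 1)), g 0 = D.root ∧
      ∀ v e, D.rot v (g e) = g ((ofPos (blockPerm m i j k l)).rot v e) := by
  obtain ⟨g, hg0, hg⟩ := exists_conj_finRotate (D.isCycle true) D.root
  -- In the new labels, the face step times the shift is the clockwise rotation at the non-root
  -- vertex, hence a full cycle.
  have h1 : g⁻¹ * D.faceStep * g * finRotate (m + 1) = g⁻¹ * (D.rot false)⁻¹ * g := by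
    rw [faceStep, mul_assoc, ← hg]
    group
  have h2 : (g⁻¹ * D.faceStep * g * finRotate (m + 1)).IsCycleOn Set.univ := by
    rw [h1]
    simpa using isCycleOn_univ_conj (Perm.isCycleOn_inv.2 (D.isCycle false)) g⁻¹
  have h3 := D.hasGenus_one_iff.1 hD
  have h4 : (g⁻¹ * D.faceStep * g).cycleType = D.faceStep.cycleType := by
    simpa using Perm.cycleType_conj (σ := D.faceStep) (τ := g⁻¹)
  rw [← Perm.sum_cycleType, ← h4, Perm.sum_cycleType] at h3
  obtain ⟨x, y, z, t, hxy, hyz, hzt, hρ⟩ := exists_swap_mul_swap h2 h3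
  obtain ⟨i, j, k, l, hb, hq⟩ := exists_blockPair_of_cuts hxy hyz hzt
  have h5 : blockPerm m i j k l * ((swap x z * swap y t) * finRotate (m + 1)) =
      finRotate (m + 1) * blockPerm m i j k l := Equiv.ext (blockPerm_swap_finRotate hb hq)
  rw [← hρ, h1, ← eq_inv_mul_iff_mul_eq] at h5
  refine ⟨i, j, k, l, hb, g, hg0, fun v e => ?_⟩
  cases v with
  | true => exact Equiv.congr_fun hg e
  | false =>
    refine Equiv.congr_fun (?_ : D.rot false * g = g * _) e
    have h6 := congrArg (·⁻¹) h5
    simp only [mul_inv_rev, inv_inv] at h6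
    rw [ofPos_rot_false, mul_assoc _ _ (blockPerm m i j k l), ← mul_assoc g]
    rw [← mul_assoc] at h6
    rw [mul_assoc g, ← mul_assoc _ _ (blockPerm m i j k l), ← h6]
    group

/-- The rotation at the root vertex forces `π = 1`. The two rotations at the other vertex then
agree, so `P' * P⁻¹` commutes with the shift and fixes 0. -/
theorem eq_of_iso_ofPos {P P' π : Perm (Fin (m + 1))} (hP : P 0 = 0) (hP' : P' 0 = 0)
    (h : ∀ v e, (ofPos P').rot v (π e) = π ((ofPos P).rot v e)) (h0 : π 0 = 0) :
    P = P' ∧ π = 1 := by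
  have h1 : π = 1 := by
    refine eq_one_of_commute_finRotate (Equiv.ext fun e => ?_) h0
    exact (h true e).symm
  subst h1
  refine ⟨?_, rfl⟩
  have h2 : P'⁻¹ * (finRotate (m + 1))⁻¹ * P' = P⁻¹ * (finRotate (m + 1))⁻¹ * P :=
    Equiv.ext (h false)
  have h3 : Commute (P' * P⁻¹) (finRotate (m + 1))⁻¹ := by
    have h4 := congrArg (fun x => P' * x * P⁻¹) h2
    simp only [mul_assoc, mul_inv_cancel_left, mul_inv_cancel, mul_one] at h4
    rw [Commute, SemiconjBy, mul_assoc, h4]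
  have h5 := eq_one_of_commute_finRotate (Commute.inv_right_iff.1 h3)
    (by rw [Perm.mul_apply, Perm.inv_eq_iff_eq.2 hP.symm, hP'])
  exact (mul_inv_eq_one.1 h5).symm

end RootedDipole

theorem eq_of_blockPerm_eq {m i j k l i' j' k' l' : ℕ} (h : IsBlockPair (m + 1) i j k l)
    (h' : IsBlockPair (m + 1) i' j' k' l') (he : blockPerm m i j k l = blockPerm m i' j' k' l') :
    i = i' ∧ j = j' ∧ k = k' ∧ l = l' := by
  refine eq_of_blockPos_eq h h' fun e hlt => ?_
  rw [← blockPerm_val h ⟨e, hlt⟩, ← blockPerm_val h' ⟨e, hlt⟩, he]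

theorem ncard_eq_of_forall_mem_iff {m : ℕ} (S : Set (Fin (m + 1))) {lo hi : ℕ} (hhi : hi ≤ m + 1)
    (h : ∀ e : Fin (m + 1), e ∈ S ↔ lo ≤ e.val ∧ e.val < hi) : S.ncard = hi - lo := by
  have : Fin.val '' S = ((Finset.Ico lo hi : Finset ℕ) : Set ℕ) := by
    ext x
    simp only [Set.mem_image, h, Finset.coe_Ico, Set.mem_Ico]
    exact ⟨fun ⟨e, he, hx⟩ => hx ▸ he, fun hx => ⟨⟨x, by omega⟩, hx, rfl⟩⟩
  rw [← Set.ncard_image_of_injective S Fin.val_injective, this, Set.ncard_coe_finset, Nat.card_Ico]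

/-! ### Edge types in the normal form -/

namespace BirootedDipole

section Iso

variable {n : ℕ} {D D' : BirootedDipole n} {π : Perm (Fin n)}

theorem between_of_iso (h : ∀ v e, D'.rot v (π e) = π (D.rot v e)) (v : Bool) (x e y : Fin n) :
    D'.Between v (π x) (π e) (π y) ↔ D.Between v x e y := by
  have hp : ∀ (i : ℕ) x, ((D'.rot v) ^ i) (π x) = π (((D.rot v) ^ i) x) := fun i x => by
    induction i with
    | zero => rfl
    | succ i ih => rw [pow_succ', Perm.mul_apply, ih, h, pow_succ', Perm.mul_apply]
  simp only [Between, hp, π.injective.eq_iff]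

theorem HasType.of_iso {a b c d : ℕ} (h : ∀ v e, D'.rot v (π e) = π (D.rot v e))
    (hr : D'.root = π D.root) (hs : D'.secondary = π D.secondary) (ht : D.HasType a b c d) :
    D'.HasType a b c d := by
  have key : ∀ p p' : Fin n → Prop, (∀ e, p' (π e) ↔ p e) →
      {e | p' e}.ncard = {e | p e}.ncard := fun p p' hp => by
    rw [← Set.ncard_image_of_injective {e | p e} π.injective]
    congr 1
    ext e
    obtain ⟨e, rfl⟩ := π.surjective e
    simp [hp]
  have r1 : ∀ e, D'.InRegion1 (π e) ↔ D.InRegion1 e := fun e => by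
    rw [InRegion1, hr, hs]; exact between_of_iso h ..
  have r2 : ∀ e, D'.InRegion2 (π e) ↔ D.InRegion2 e := fun e => by
    rw [InRegion2, hr, hs]; exact between_of_iso h ..
  have r3 : ∀ e, D'.InRegion3 (π e) ↔ D.InRegion3 e := fun e => by
    rw [InRegion3, hr, hs]; exact between_of_iso h ..
  have r4 : ∀ e, D'.InRegion4 (π e) ↔ D.InRegion4 e := fun e => by
    rw [InRegion4, hr, hs]; exact between_of_iso h ..
  obtain ⟨h1, h2, h3, h4⟩ := ht
  exact ⟨(key _ _ fun e => and_congr (r2 e) (r3 e)).trans h1,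
    (key _ _ fun e => and_congr (r1 e) (r3 e)).trans h2,
    (key _ _ fun e => and_congr (r2 e) (r4 e)).trans h3,
    (key _ _ fun e => and_congr (r1 e) (r4 e)).trans h4⟩

end Iso

variable {m : ℕ}

/-- The standard rooted dipole with position permutation `P`, with secondary edge `s`. -/
def ofPos (P : Perm (Fin (m + 1))) (s : Fin (m + 1)) (hs : s ≠ 0) : BirootedDipole (m + 1) where
  toRootedDipole := RootedDipole.ofPos P
  secondary := s
  secondary_ne := hs

variable {P : Perm (Fin (m + 1))} {s : Fin (m + 1)} {hs : s ≠ 0}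

theorem inRegion1_ofPos (e : Fin (m + 1)) : (ofPos P s hs).InRegion1 e ↔ 0 < e ∧ e < s := by
  simp only [Fin.lt_def, Fin.val_zero]
  constructor
  · rintro ⟨i, j, hi, hij, hj, h1, h2⟩
    change (finRotate (m + 1) ^ i) 0 = e at h1
    change (finRotate (m + 1) ^ j) 0 = s at h2
    have a1 := val_finRotate_pow (0 : Fin (m + 1)) (i := i) (by omega)
    have a2 := val_finRotate_pow (0 : Fin (m + 1)) (i := j) (by omega)
    rw [h1, Fin.val_zero] at a1
    rw [h2, Fin.val_zero] at a2
    omega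
  · rintro ⟨h1, h2⟩
    exact ⟨e, s, h1, h2, s.2, finRotate_pow_zero e, finRotate_pow_zero s⟩

theorem inRegion2_ofPos (e : Fin (m + 1)) : (ofPos P s hs).InRegion2 e ↔ s < e := by
  have hs' : s.val ≠ 0 := fun h => hs (Fin.ext h)
  have := s.2
  have := e.2
  rw [Fin.lt_def]
  constructor
  · rintro ⟨i, j, hi, hij, hj, h1, h2⟩
    change (finRotate (m + 1) ^ i) s = e at h1
    change (finRotate (m + 1) ^ j) s = 0 at h2
    have a1 := val_finRotate_pow s (i := i) (by omega)
    have a2 := val_finRotate_pow s (i := j) (by omega)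
    rw [h1] at a1
    rw [h2, Fin.val_zero] at a2
    omega
  · intro h
    have a1 := val_finRotate_pow s (i := e.val - s.val) (by omega)
    have a2 := val_finRotate_pow s (i := m + 1 - s.val) (by omega)
    refine ⟨e.val - s.val, m + 1 - s.val, by omega, by omega, by omega, Fin.ext ?_, Fin.ext ?_⟩
    · change ((finRotate (m + 1) ^ (e.val - s.val)) s).val = e.val
      omega
    · change ((finRotate (m + 1) ^ (m + 1 - s.val)) s).val = 0
      omega

theorem rot_false_pow_ofPos (i : ℕ) (x y : Fin (m + 1)) :
    ((ofPos P s hs).rot false ^ i) x = y ↔ (finRotate (m + 1) ^ i) (P y) = P x := by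
  have h : (ofPos P s hs).rot false = P⁻¹ * (finRotate (m + 1))⁻¹ * P⁻¹⁻¹ := by
    rw [inv_inv]; rfl
  rw [h, conj_pow, inv_inv, inv_pow, Perm.mul_apply, Perm.mul_apply, Perm.inv_eq_iff_eq,
    Perm.inv_eq_iff_eq, eq_comm]

/-- Counterclockwise at the non-root vertex means decreasing position, starting from the root edge
at 0, read as `m + 1`. -/
theorem inRegion3_ofPos (hP : P 0 = 0) (e : Fin (m + 1)) :
    (ofPos P s hs).InRegion3 e ↔ P s < P e := by
  have hs' : (P s).val ≠ 0 := fun h => hs (P.injective ((Fin.ext h : P s = 0).trans hP.symm))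
  have := (P s).2
  have := (P e).2
  rw [Fin.lt_def]
  unfold InRegion3 Between
  simp only [rot_false_pow_ofPos]
  change (∃ i j, _ ∧ _ ∧ _ ∧ (finRotate (m + 1) ^ i) (P e) = P 0 ∧
    (finRotate (m + 1) ^ j) (P s) = P 0) ↔ _
  rw [hP]
  generalize P s = p at *
  generalize P e = q at *
  constructor
  · rintro ⟨i, j, hi, hij, hj, h1, h2⟩
    have a1 := val_finRotate_pow q (i := i) (by omega)
    have a2 := val_finRotate_pow p (i := j) (by omega)
    rw [h1, Fin.val_zero] at a1
    rw [h2, Fin.val_zero] at a2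
    omega
  · intro h
    have a1 := val_finRotate_pow q (i := m + 1 - q.val) (by omega)
    have a2 := val_finRotate_pow p (i := m + 1 - p.val) (by omega)
    refine ⟨m + 1 - q.val, m + 1 - p.val, by omega, by omega, by omega, Fin.ext ?_, Fin.ext ?_⟩
    · rw [Fin.val_zero]; omega
    · rw [Fin.val_zero]; omega

theorem inRegion4_ofPos (hP : P 0 = 0) (e : Fin (m + 1)) :
    (ofPos P s hs).InRegion4 e ↔ 0 < P e ∧ P e < P s := by
  have := (P s).2
  have := (P e).2
  rw [Fin.lt_def, Fin.lt_def, Fin.val_zero]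
  unfold InRegion4 Between
  simp only [rot_false_pow_ofPos]
  change (∃ i j, _ ∧ _ ∧ _ ∧ (finRotate (m + 1) ^ i) (P e) = P s ∧
    (finRotate (m + 1) ^ j) (P 0) = P s) ↔ _
  rw [hP]
  generalize P s = p at *
  generalize P e = q at *
  constructor
  · rintro ⟨i, j, hi, hij, hj, h1, h2⟩
    have a1 := val_finRotate_pow q (i := i) (by omega)
    have a2 := val_finRotate_pow (0 : Fin (m + 1)) (i := j) (by omega)
    rw [h1] at a1
    rw [h2, Fin.val_zero] at a2
    omega
  · rintro ⟨h, h'⟩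
    have a1 := val_finRotate_pow q (i := p.val - q.val) (by omega)
    refine ⟨p.val - q.val, p.val, by omega, by omega, p.2, Fin.ext ?_, finRotate_pow_zero p⟩
    omega

/-- Region 1 consists of the `s - 1` labels strictly between 0 and `s`, Region 2 of the `m - s`
labels above `s`. Hence `s`, `b` and `c` determine `d` and `a`. -/
theorem hasType_ofPos_iff (hP : P 0 = 0) {a b c d : ℕ} (hm : a + b + c + d + 1 = m) :
    (ofPos P s hs).HasType a b c d ↔ s.val = b + d + 1 ∧
      {e | e < s ∧ P s < P e}.ncard = b ∧ {e | s < e ∧ P e < P s}.ncard = c := by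
  have hs' : s.val ≠ 0 := fun h => hs (Fin.ext h)
  have hslt := s.2
  have hP' : ∀ e, e ≠ 0 → 0 < P e := fun e he =>
    Fin.pos_iff_ne_zero.2 fun h => he (P.injective (h.trans hP.symm))
  have hne : ∀ e, e ≠ s → P e < P s ∨ P s < P e := fun e he =>
    lt_or_gt_of_ne fun h => he (P.injective h)
  have e1 : {e | 0 < e ∧ e < s ∧ P s < P e} = {e | e < s ∧ P s < P e} := by
    ext e
    refine ⟨fun h => h.2, fun h => ⟨Fin.pos_iff_ne_zero.2 ?_, h⟩⟩
    rintro rfl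
    have := h.2
    rw [hP] at this
    exact absurd this (Fin.not_lt_zero _)
  have e2 : {e | s < e ∧ 0 < P e ∧ P e < P s} = {e | s < e ∧ P e < P s} := by
    ext e
    refine ⟨fun h => ⟨h.1, h.2.2⟩, fun h => ⟨h.1, hP' e ?_, h.2⟩⟩
    rintro rfl
    exact absurd h.1 (Fin.not_lt_zero _)
  have n1 : {e | e < s ∧ P s < P e}.ncard + {e | (0 < e ∧ e < s) ∧ 0 < P e ∧ P e < P s}.ncard =
      s.val - 1 := by
    rw [← ncard_eq_of_forall_mem_iff {e | 0 < e ∧ e < s} (lo := 1) hslt.le fun e => Iff.rfl, ← e1,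
      ← Set.ncard_union_eq]
    · congr 1
      ext e
      simp only [Set.mem_union, Set.mem_ofPred_eq]
      constructor
      · rintro (h | h)
        · exact ⟨h.1, h.2.1⟩
        · exact h.1
      · intro h
        rcases hne e h.2.ne with h' | h'
        · exact .inr ⟨h, hP' e (Fin.pos_iff_ne_zero.1 h.1), h'⟩
        · exact .inl ⟨h.1, h.2, h'⟩
    · exact Set.disjoint_left.2 fun e h h' => lt_asymm h.2.2 h'.2.2
  have n2 : {e | s < e ∧ P e < P s}.ncard + {e | s < e ∧ P s < P e}.ncard = m - s.val := by
    rw [show m - s.val = m + 1 - (s.val + 1) by omega,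
      ← ncard_eq_of_forall_mem_iff {e | s < e} (lo := s.val + 1) le_rfl
        (fun e => ⟨fun h => ⟨h, e.2⟩, fun h => h.1⟩), ← Set.ncard_union_eq]
    · congr 1
      ext e
      simp only [Set.mem_union, Set.mem_ofPred_eq]
      constructor
      · rintro (h | h) <;> exact h.1
      · intro h
        rcases hne e h.ne' with h' | h'
        · exact .inl ⟨h, h'⟩
        · exact .inr ⟨h, h'⟩
    · exact Set.disjoint_left.2 fun e h h' => lt_asymm h.2 h'.2
  unfold HasType
  simp only [inRegion1_ofPos, inRegion2_ofPos, inRegion3_ofPos hP, inRegion4_ofPos hP, and_assoc]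
    at n1 ⊢
  rw [e1, e2]
  omega

end BirootedDipole

/-! ### Crossings of the secondary edge, and torus dipoles as quadruples -/

/-- The possible numbers `b`, `c` of edges crossing the edge `s` from below and from above in the
block interchange. -/
def BlockCrossing (i j k l s b c : ℕ) : Prop :=
  (s < i ∧ b = 0 ∧ c = 0) ∨ (i ≤ s ∧ s < j ∧ b = 0 ∧ c = l - j) ∨
    (j ≤ s ∧ s < k ∧ b = j - i ∧ c = l - k) ∨ (k ≤ s ∧ s < l ∧ b = k - i ∧ c = 0) ∨
      (l ≤ s ∧ b = 0 ∧ c = 0)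

theorem blockCrossing_ncard {m i j k l : ℕ} (h : IsBlockPair (m + 1) i j k l) (s : Fin (m + 1)) :
    BlockCrossing i j k l s
      {e | e < s ∧ blockPerm m i j k l s < blockPerm m i j k l e}.ncard
      {e | s < e ∧ blockPerm m i j k l e < blockPerm m i j k l s}.ncard := by
  have hb := blockPerm_val h
  simp only [Fin.lt_def, hb]
  have hlow : ∀ lo hi, hi ≤ m + 1 → (∀ e : Fin (m + 1), (e.val < s.val ∧
      blockPos i j k l s < blockPos i j k l e) ↔ lo ≤ e.val ∧ e.val < hi) → _ :=
    fun lo hi h1 h2 => ncard_eq_of_forall_mem_iff _ h1 h2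
  have hupp : ∀ lo hi, hi ≤ m + 1 → (∀ e : Fin (m + 1), (s.val < e.val ∧
      blockPos i j k l e < blockPos i j k l s) ↔ lo ≤ e.val ∧ e.val < hi) → _ :=
    fun lo hi h1 h2 => ncard_eq_of_forall_mem_iff _ h1 h2
  have hs := blockPos_cases i j k l s
  have hs' := s.2
  unfold IsBlockPair at h
  unfold BlockCrossing
  by_cases c1 : s.val < i
  · have x1 := hlow 0 0 (by omega) fun e => by have := blockPos_cases i j k l e; omega
    have x2 := hupp 0 0 (by omega) fun e => by have := blockPos_cases i j k l e; omega
    exact .inl ⟨c1, x1, x2⟩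
  by_cases c2 : s.val < j
  · have x1 := hlow 0 0 (by omega) fun e => by have := blockPos_cases i j k l e; omega
    have x2 := hupp j l (by omega) fun e => by have := blockPos_cases i j k l e; omega
    exact .inr (.inl ⟨by omega, c2, x1, x2⟩)
  by_cases c3 : s.val < k
  · have x1 := hlow i j (by omega) fun e => by have := blockPos_cases i j k l e; omega
    have x2 := hupp k l (by omega) fun e => by have := blockPos_cases i j k l e; omega
    exact .inr (.inr (.inl ⟨by omega, c3, x1, x2⟩))
  by_cases c4 : s.val < l
  · have x1 := hlow i k (by omega) fun e => by have := blockPos_cases i j k l e; omega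
    have x2 := hupp 0 0 (by omega) fun e => by have := blockPos_cases i j k l e; omega
    exact .inr (.inr (.inr (.inl ⟨by omega, c4, x1, x2⟩)))
  · have x1 := hlow 0 0 (by omega) fun e => by have := blockPos_cases i j k l e; omega
    have x2 := hupp 0 0 (by omega) fun e => by have := blockPos_cases i j k l e; omega
    exact .inr (.inr (.inr (.inr ⟨by omega, x1, x2⟩)))

/-- The five pieces of the word are disjoint, so `s` lies in only one and the crossing numbers are
functions of `s`. -/
theorem blockCrossing_iff {m i j k l b c : ℕ} (h : IsBlockPair (m + 1) i j k l)
    (s : Fin (m + 1)) :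
    BlockCrossing i j k l s b c ↔
      {e | e < s ∧ blockPerm m i j k l s < blockPerm m i j k l e}.ncard = b ∧
      {e | s < e ∧ blockPerm m i j k l e < blockPerm m i j k l s}.ncard = c := by
  have := blockCrossing_ncard h s
  constructor
  · intro h'
    unfold IsBlockPair at h
    unfold BlockCrossing at this h'
    omega
  · rintro ⟨rfl, rfl⟩
    exact this

/-- The admissible quadruples of block ends. -/
def blockPairs (n : ℕ) : Set (ℕ × ℕ × ℕ × ℕ) :=
  {q | IsBlockPair n q.1 q.2.1 q.2.2.1 q.2.2.2}

/-- The number of isomorphism classes of `(a, b, c, d)`-dipoles on the torus. -/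
theorem numDipoles_one (a b c d : ℕ) :
    numDipoles 1 a b c d = {q | q ∈ blockPairs (a + b + c + d + 2) ∧
      BlockCrossing q.1 q.2.1 q.2.2.1 q.2.2.2 (b + d + 1) b c}.ncard := by
  obtain ⟨m, hm⟩ : ∃ m, a + b + c + d + 1 = m := ⟨_, rfl⟩
  unfold numDipoles
  rw [show a + b + c + d + 2 = m + 1 by omega]
  -- Region 1 holds the `b + d` edges following the root edge 0, which fixes the label of the
  -- secondary edge.
  let s : Fin (m + 1) := ⟨b + d + 1, by omega⟩
  have hs : s ≠ 0 := fun h => by simpa [s] using congrArg Fin.val h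
  let f : ℕ × ℕ × ℕ × ℕ → Quotient (BirootedDipole.isoSetoid (m + 1)) := fun q =>
    Quotient.mk _ (BirootedDipole.ofPos (blockPerm m q.1 q.2.1 q.2.2.1 q.2.2.2) s hs)
  rw [← Set.InjOn.ncard_image (f := f)]
  · congr 1
    ext x
    constructor
    · rintro ⟨D, ⟨hg, ht⟩, rfl⟩
      obtain ⟨i, j, k, l, hb, g, hg0, hrot⟩ := RootedDipole.exists_blockPerm_of_hasGenus_one hg
      let D' := BirootedDipole.ofPos (blockPerm m i j k l) (g⁻¹ D.secondary) (fun h =>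
        D.secondary_ne (by rw [← hg0]; exact Perm.inv_eq_iff_eq.1 h))
      have hiso : (BirootedDipole.isoSetoid (m + 1)).r D' D :=
        ⟨g, hrot, hg0.symm, by simp [D', BirootedDipole.ofPos]⟩
      obtain ⟨g', h1, h2, h3⟩ := (BirootedDipole.isoSetoid (m + 1)).symm hiso
      have ht' : D'.HasType a b c d := ht.of_iso h1 h2 h3
      rw [BirootedDipole.hasType_ofPos_iff (blockPerm_zero hb) hm] at ht'
      obtain ⟨hsec, hbc⟩ := ht'
      have hsec' : g⁻¹ D.secondary = s := Fin.ext hsec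
      rw [hsec'] at hbc
      refine ⟨(i, j, k, l), ⟨hb, (blockCrossing_iff hb s).2 hbc⟩, ?_⟩
      refine Quotient.sound ?_
      change (BirootedDipole.isoSetoid (m + 1)).r _ D
      convert hiso
      exact hsec'.symm
    · rintro ⟨⟨i, j, k, l⟩, ⟨hb, hbc⟩, rfl⟩
      refine ⟨BirootedDipole.ofPos (blockPerm m i j k l) s hs,
        ⟨RootedDipole.hasGenus_one_ofPos_blockPerm hb, ?_⟩, rfl⟩
      rw [BirootedDipole.hasType_ofPos_iff (blockPerm_zero hb) hm]
      exact ⟨rfl, (blockCrossing_iff hb s).1 hbc⟩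
  · rintro ⟨i, j, k, l⟩ ⟨hb, -⟩ ⟨i', j', k', l'⟩ ⟨hb', -⟩ h
    obtain ⟨π, h1, h2, -⟩ := Quotient.exact h
    have h3 := RootedDipole.eq_of_iso_ofPos (blockPerm_zero hb) (blockPerm_zero hb') h1 h2.symm
    obtain ⟨rfl, rfl, rfl, rfl⟩ := eq_of_blockPerm_eq hb hb' h3.1
    rfl

/-! ### Rooted torus dipoles and the numbers `ψ` -/

theorem image_mk_hasGenus_one (m : ℕ) :
    Quotient.mk (RootedDipole.isoSetoid (m + 1)) '' {D | D.HasGenus 1} =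
      (fun q => Quotient.mk _ (RootedDipole.ofPos (blockPerm m q.1 q.2.1 q.2.2.1 q.2.2.2))) ''
        blockPairs (m + 1) := by
  ext x
  constructor
  · rintro ⟨D, hg, rfl⟩
    obtain ⟨i, j, k, l, hb, g, hg0, hrot⟩ := RootedDipole.exists_blockPerm_of_hasGenus_one hg
    exact ⟨(i, j, k, l), hb, Quotient.sound ⟨g, hrot, hg0.symm⟩⟩
  · rintro ⟨⟨i, j, k, l⟩, hb, rfl⟩
    exact ⟨_, RootedDipole.hasGenus_one_ofPos_blockPerm hb, rfl⟩

theorem ncard_image_mk_hasGenus_one (m : ℕ) :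
    (Quotient.mk (RootedDipole.isoSetoid (m + 1)) '' {D | D.HasGenus 1}).ncard =
      (blockPairs (m + 1)).ncard := by
  rw [image_mk_hasGenus_one, Set.InjOn.ncard_image]
  rintro ⟨i, j, k, l⟩ hb ⟨i', j', k', l'⟩ hb' h
  obtain ⟨π, h1, h2⟩ := Quotient.exact h
  have h3 := RootedDipole.eq_of_iso_ofPos (blockPerm_zero hb) (blockPerm_zero hb') h1 h2.symm
  obtain ⟨rfl, rfl, rfl, rfl⟩ := eq_of_blockPerm_eq hb hb' h3.1
  rfl

theorem finite_blockPairs (n : ℕ) : (blockPairs n).Finite := by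
  refine ((Set.finite_Iic n).prod ((Set.finite_Iic n).prod
    ((Set.finite_Iic n).prod (Set.finite_Iic n)))).subset ?_
  rintro ⟨i, j, k, l⟩ h
  simp only [blockPairs, IsBlockPair, Set.mem_ofPred_eq] at h
  simp only [Set.mem_prod, Set.mem_Iic]
  omega

namespace RootedDipole

/-- All face degrees are even. Their halves sum to the number `m + 1` of edges, and on the torus
there are `m - 1` faces, so the halves have excess 2. -/
theorem hasGenus_one_iff_faceDegrees {m : ℕ} (D : RootedDipole (m + 1)) :
    D.HasGenus 1 ↔
      (2 ≤ m ∧ D.faceDegrees = (3 ::ₘ Multiset.replicate (m - 2) 1).map (fun k => 2 * k)) ∨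
      (3 ≤ m ∧ D.faceDegrees =
        (2 ::ₘ 2 ::ₘ Multiset.replicate (m - 3) 1).map (fun k => 2 * k)) := by
  have hcard : D.HasGenus 1 ↔ Multiset.card D.faceDegrees + 2 = m + 1 := by
    unfold HasGenus
    omega
  rw [hcard]
  constructor
  · intro h
    obtain ⟨N, hN⟩ : ∃ N : Multiset ℕ, D.faceDegrees = N.map (fun k => 2 * k) := by
      refine ⟨D.faceDegrees.map (· / 2), ?_⟩
      rw [Multiset.map_map]
      conv_lhs => rw [← Multiset.map_id D.faceDegrees]
      exact Multiset.map_congr rfl fun k hk =>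
        (Nat.mul_div_cancel' (D.even_of_mem_faceDegrees hk).two_dvd).symm
    have hsum : N.sum = m + 1 := by
      have h1 := D.sum_faceDegrees
      rw [hN, Multiset.sum_map_mul_left, Multiset.map_id'] at h1
      omega
    rw [hN, Multiset.card_map] at h
    have hpos : ∀ x ∈ N, 1 ≤ x := fun x hx => by
      have : 2 * x ∈ D.faceDegrees := by
        rw [hN]
        exact Multiset.mem_map_of_mem _ hx
      have := Equiv.Perm.two_le_of_mem_cycleType this
      omega
    rw [hN]
    rcases Multiset.eq_of_sum_eq_card_add_two hpos (by omega) with h1 | ⟨h2, h1⟩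
    · left
      have : 1 ≤ N.card := by rw [h1]; simp
      rw [show m - 2 = N.card - 1 by omega, ← h1]
      exact ⟨by omega, rfl⟩
    · right
      rw [show m - 3 = N.card - 2 by omega, ← h1]
      exact ⟨by omega, rfl⟩
  · rintro (⟨h1, h2⟩ | ⟨h1, h2⟩) <;> rw [h2] <;> simp <;> omega

end RootedDipole

theorem psi_eq_ncard {l : Multiset ℕ} {n : ℕ} (h : l.sum = n) :
    psi l = (Quotient.mk (RootedDipole.isoSetoid n) ''
      {D | D.faceDegrees = l.map (fun k => 2 * k)}).ncard := by
  subst h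
  rfl

theorem psiThree_eq_ncard (m : ℕ) :
    psiThree ((m : ℤ) - 2) = (Quotient.mk (RootedDipole.isoSetoid (m + 1)) '' {D | 2 ≤ m ∧
      D.faceDegrees = (3 ::ₘ Multiset.replicate (m - 2) 1).map (fun k => 2 * k)}).ncard := by
  unfold psiThree
  by_cases h : 2 ≤ m
  · rw [if_pos (by omega), show ((m : ℤ) - 2).toNat = m - 2 by omega,
      psi_eq_ncard (n := m + 1) (by simp; omega)]
    simp only [h, true_and]
  · rw [if_neg (by omega)]
    simp [h]

theorem psiTwoTwo_eq_ncard (m : ℕ) :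
    psiTwoTwo ((m : ℤ) - 3) = (Quotient.mk (RootedDipole.isoSetoid (m + 1)) '' {D | 3 ≤ m ∧
      D.faceDegrees = (2 ::ₘ 2 ::ₘ Multiset.replicate (m - 3) 1).map (fun k => 2 * k)}).ncard := by
  unfold psiTwoTwo
  by_cases h : 3 ≤ m
  · rw [if_pos (by omega), show ((m : ℤ) - 3).toNat = m - 3 by omega,
      psi_eq_ncard (n := m + 1) (by simp; omega)]
    simp only [h, true_and]
  · rw [if_neg (by omega)]
    simp [h]

/-- The two kinds of face degree sequences are those of the rooted dipoles on the torus. -/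
theorem psiThree_add_psiTwoTwo (m : ℕ) :
    psiThree ((m : ℤ) - 2) + psiTwoTwo ((m : ℤ) - 3) = (blockPairs (m + 1)).ncard := by
  rw [← ncard_image_mk_hasGenus_one, psiThree_eq_ncard, psiTwoTwo_eq_ncard]
  have hfin : (Quotient.mk (RootedDipole.isoSetoid (m + 1)) '' {D | D.HasGenus 1}).Finite := by
    rw [image_mk_hasGenus_one]
    exact (finite_blockPairs _).image _
  simp only [RootedDipole.hasGenus_one_iff_faceDegrees, Set.ofPred_or, Set.image_union] at hfin ⊢
  rw [Set.ncard_union_eq _ (hfin.subset Set.subset_union_left)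
    (hfin.subset Set.subset_union_right)]
  rw [Set.disjoint_left]
  rintro _ ⟨D, ⟨-, h⟩, rfl⟩ ⟨D', ⟨-, h'⟩, hD⟩
  obtain ⟨π, h1, -⟩ := Quotient.exact hD
  rw [RootedDipole.faceDegrees_eq_of_iso h1, h'] at h
  -- The two families of classes are disjoint: a hexagonal face occurs only in the first.
  have : 6 ∈ (2 ::ₘ 2 ::ₘ Multiset.replicate (m - 3) 1).map (fun k => 2 * k) := by
    rw [h]; simp
  obtain ⟨k, hk, hk6⟩ := Multiset.mem_map.1 this
  simp only [Multiset.mem_cons] at hk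
  rcases hk with rfl | rfl | hk
  · omega
  · omega
  · have := Multiset.eq_of_mem_replicate hk
    omega

/-- The inequalities say `0 ≤ i - 1 < j - 1 < k < l ≤ n`, so a quadruple is a 4-element subset of an
`(n + 1)`-element set. -/
theorem ncard_blockPairs (n : ℕ) : (blockPairs n).ncard = (n + 1).choose 4 := by
  have h1 : ∀ p N, ∑ x ∈ Finset.range N, x.choose p = N.choose (p + 1) := fun p N => by
    induction N with
    | zero => simp
    | succ N ih => rw [Finset.sum_range_succ, ih, Nat.choose_succ_succ' N p, add_comm]
  let F : Finset (Σ _ : ℕ, Σ _ : ℕ, Σ _ : ℕ, ℕ) := (Finset.range (n + 1)).sigma fun l =>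
    (Finset.range l).sigma fun k => (Finset.range k).sigma fun j => Finset.range j
  let f : (Σ _ : ℕ, Σ _ : ℕ, Σ _ : ℕ, ℕ) → ℕ × ℕ × ℕ × ℕ := fun x =>
    (x.2.2.2 + 1, x.2.2.1 + 1, x.2.1, x.1)
  have hF : F.card = (n + 1).choose 4 := by
    have h2 : ∀ j : ℕ, j = j.choose 1 := fun j => (Nat.choose_one_right j).symm
    simp only [F, Finset.card_sigma, Finset.card_range]
    simp_rw [fun k => (Finset.sum_congr rfl fun j _ => h2 j :
      ∑ j ∈ Finset.range k, j = ∑ j ∈ Finset.range k, j.choose 1), h1]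
  have himg : blockPairs n = f '' (F : Set _) := by
    ext ⟨i, j, k, l⟩
    simp only [blockPairs, IsBlockPair, Set.mem_ofPred_eq, Set.mem_image, Finset.mem_coe, F,
      Finset.mem_sigma, Finset.mem_range, f, Prod.mk.injEq]
    constructor
    · intro h
      exact ⟨⟨l, k, j - 1, i - 1⟩, by dsimp only; omega, by dsimp only; omega⟩
    · rintro ⟨⟨l, k, j, i⟩, h, h'⟩
      dsimp only at h h'
      omega
  rw [himg, Set.InjOn.ncard_image, Set.ncard_coe_finset, hF]
  rintro ⟨l, k, j, i⟩ - ⟨l', k', j', i'⟩ - h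
  simp only [f, Prod.mk.injEq, add_left_inj] at h
  obtain ⟨rfl, rfl, rfl, rfl⟩ := h
  rfl

/-! ### Counting the quadruples of each type -/

theorem ncard_eq_of_image_range {S : Set (ℕ × ℕ × ℕ × ℕ)} (f : ℕ × ℕ × ℕ → ℕ × ℕ × ℕ × ℕ)
    (u v w : ℕ) (hf : Function.Injective f)
    (h : ∀ q, q ∈ S ↔ ∃ x y z, (x < u ∧ y < v ∧ z < w) ∧ f (x, y, z) = q) :
    S.ncard = u * (v * w) := by
  have : S = f '' ((Finset.range u ×ˢ Finset.range v ×ˢ Finset.range w : Finset _) : Set _) := by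
    ext q
    rw [h]
    simp [Set.mem_image]
  rw [this, Set.ncard_image_of_injective _ hf, Set.ncard_coe_finset]
  simp

/-- Here `s` lies in the block `[k, l)` and `k = i + b`; the free choices are `i ≤ d + 1`, `j` in
`(i, k]` and `l > s`. -/
theorem numDipoles_one_of_pos_of_zero {a b d : ℕ} (hb : 1 ≤ b) :
    numDipoles 1 a b 0 d = (a + 1) * b * (d + 1) := by
  rw [numDipoles_one, ncard_eq_of_image_range
    (fun x => (x.1 + 1, x.1 + 1 + x.2.1 + 1, x.1 + 1 + b, b + d + 2 + x.2.2)) (d + 1) b (a + 1)]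
  · ring
  · rintro ⟨x, y, z⟩ ⟨x', y', z'⟩ h
    simp only [Prod.mk.injEq] at h ⊢
    omega
  · rintro ⟨i, j, k, l⟩
    simp only [blockPairs, IsBlockPair, BlockCrossing, Set.mem_ofPred_eq, and_true, Prod.mk.injEq]
    constructor
    · intro h
      exact ⟨i - 1, j - i - 1, l - (b + d + 2), by omega, by omega⟩
    · rintro ⟨x, y, z, h, h'⟩
      omega

/-- Here `s` lies in the middle piece, and the blocks have lengths `b` and `c`; only `i` and `k` are
free. -/
theorem numDipoles_one_of_pos_of_pos {a b c d : ℕ} (hb : 1 ≤ b) (hc : 1 ≤ c) :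
    numDipoles 1 a b c d = (a + 1) * (d + 1) := by
  rw [numDipoles_one, ncard_eq_of_image_range
    (fun x => (x.1 + 1, x.1 + 1 + b, b + d + 2 + x.2.2, b + d + 2 + x.2.2 + c + x.2.1))
    (d + 1) 1 (a + 1)]
  · ring
  · rintro ⟨x, y, z⟩ ⟨x', y', z'⟩ h
    simp only [Prod.mk.injEq] at h ⊢
    omega
  · rintro ⟨i, j, k, l⟩
    simp only [blockPairs, IsBlockPair, BlockCrossing, Set.mem_ofPred_eq, Prod.mk.injEq]
    constructor
    · intro h
      exact ⟨i - 1, 0, k - (b + d + 2), by omega, by omega⟩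
    · rintro ⟨x, y, z, h, h'⟩
      omega

/-- Here `s` lies in the block `[i, j)` and `l = j + c`; the free choices are `i ≤ d + 1`, `j > s`
and `k` in `[j, l)`. -/
theorem numDipoles_one_of_zero_of_pos {a c d : ℕ} (hc : 1 ≤ c) :
    numDipoles 1 a 0 c d = (a + 1) * c * (d + 1) := by
  rw [numDipoles_one, ncard_eq_of_image_range
    (fun x => (x.1 + 1, d + 2 + x.2.2, d + 2 + x.2.2 + x.2.1, d + 2 + x.2.2 + c))
    (d + 1) c (a + 1)]
  · ring
  · rintro ⟨x, y, z⟩ ⟨x', y', z'⟩ h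
    simp only [Prod.mk.injEq] at h ⊢
    omega
  · rintro ⟨i, j, k, l⟩
    simp only [blockPairs, IsBlockPair, BlockCrossing, Set.mem_ofPred_eq, true_and, Prod.mk.injEq]
    constructor
    · intro h
      exact ⟨i - 1, k - j, j - (d + 2), by omega, by omega⟩
    · rintro ⟨x, y, z, h, h'⟩
      omega

/-- No edge crosses `s = d + 1`, so either `l ≤ d + 1`, or `i > d + 1` and subtracting `d + 1`
leaves an arbitrary block pair for `a + 1` edges. -/
theorem numDipoles_one_of_zero_of_zero (a d : ℕ) :
    numDipoles 1 a 0 0 d = (d + 2).choose 4 + (blockPairs (a + 1)).ncard := by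
  let f : ℕ × ℕ × ℕ × ℕ → ℕ × ℕ × ℕ × ℕ := fun q =>
    (d + 1 + q.1, d + 1 + q.2.1, d + 1 + q.2.2.1, d + 1 + q.2.2.2)
  have hf : Function.Injective f := by
    rintro ⟨i, j, k, l⟩ ⟨i', j', k', l'⟩ h
    simp only [f, Prod.mk.injEq] at h ⊢
    omega
  rw [numDipoles_one, ← ncard_blockPairs (d + 1), ← Set.ncard_image_of_injective (blockPairs (a + 1)) hf,
    ← Set.ncard_union_eq _ (finite_blockPairs _) ((finite_blockPairs _).image _)]
  · congr 1
    ext ⟨i, j, k, l⟩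
    simp only [blockPairs, IsBlockPair, BlockCrossing, Set.mem_ofPred_eq, and_true, Set.mem_union,
      Set.mem_image, Prod.exists, f, Prod.mk.injEq]
    constructor
    · intro h
      by_cases hl : l ≤ d + 1
      · left; omega
      · right
        exact ⟨i - (d + 1), j - (d + 1), k - (d + 1), l - (d + 1), by omega, by omega⟩
    · rintro (h | ⟨i', j', k', l', h, h'⟩) <;> omega
  · rw [Set.disjoint_left]
    rintro _ h ⟨⟨i, j, k, l⟩, h', rfl⟩
    simp only [blockPairs, IsBlockPair, Set.mem_ofPred_eq, f] at h h'
    omega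

theorem mainTheorem7 (a b c d : ℕ) :
    (0 < c + d → 1 ≤ b →
      numDipoles 1 a b c d = if c = 0 then (a + 1) * b * (d + 1) else (a + 1) * (d + 1)) ∧
    (0 < c + d → b = 0 →
      numDipoles 1 a b c d =
        if c = 0 then
          (if 2 ≤ d then (d + 2).choose (d - 2) else 0) +
            psiThree ((a : ℤ) - 2) + psiTwoTwo ((a : ℤ) - 3)
        else if c = 1 then (a + 1) * (d + 1)
        else (a + 1) * c * (d + 1)) ∧
    (c = 0 → d = 0 → 1 ≤ b → numDipoles 1 a b c d = b * (a + 1)) ∧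
    (c = 0 → d = 0 → b = 0 →
      numDipoles 1 a b c d = psiThree ((a : ℤ) - 2) + psiTwoTwo ((a : ℤ) - 3)) := by
  refine ⟨fun _ hb => ?_, ?_, ?_, ?_⟩
  · split_ifs with hc
    · subst hc
      exact numDipoles_one_of_pos_of_zero hb
    · exact numDipoles_one_of_pos_of_pos hb (by omega)
  · rintro - rfl
    split_ifs with hc hd hc
    · subst hc
      rw [numDipoles_one_of_zero_of_zero, add_assoc, psiThree_add_psiTwoTwo,
        ← Nat.choose_symm_of_eq_add (show d + 2 = (d - 2) + 4 by omega)]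
    · subst hc
      rw [numDipoles_one_of_zero_of_zero, add_assoc, psiThree_add_psiTwoTwo,
        Nat.choose_eq_zero_of_lt (by omega)]
    · subst hc
      rw [numDipoles_one_of_zero_of_pos le_rfl, mul_one]
    · exact numDipoles_one_of_zero_of_pos (by omega)
  · rintro rfl rfl hb
    rw [numDipoles_one_of_pos_of_zero hb]
    ring
  · rintro rfl rfl rfl
    rw [numDipoles_one_of_zero_of_zero, psiThree_add_psiTwoTwo, Nat.choose_eq_zero_of_lt (by omega),
      zero_add]
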